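/- For a word $w\in\Sigma^+$ and an integer $m\ge 0$ let $i_m(w)$ and $t_m(w)$ be the prefix and the suffix of $w$ of length $m$ (or $w$ itself if $|w|<m$), and let $F_m(w)$ be the set of segments (contiguous factors) of $w$ of length $m$. A semigroup $S$ is called \emph{right [left] locally testable} if for some integer $k\ge 1$ there are a finite alphabet $\Sigma$ and a surjective morphism $\varphi:\Sigma^+\to S$ such that $\varphi(u)=\varphi(v)$ whenever $u,v\in\Sigma^+$ satisfy $i_{k-1}(u)=i_{k-1}(v)$, $t_{k-1}(u)=t_{k-1}(v)$, $F_k(u)=F_k(v)$, and the segments of length $k$ make their first appearance in the same order in the prefixes [suffixes] of increasing length of $u$ and of $v$. It is called \emph{locally idempotent} if for every idempotent $e\in S$ all elements of the subsemigroup $eSe$ are idempotent. A right [left] zero semigroup is one satisfying $xy=y$ [$xy=x$]. A common right [left] unit of $e,i\in S$ is an idempotent $f\in S$ with $ef=e$ and $if=i$ [$fe=e$ and $fi=i$]. Theorem. A finite semigroup $S$ is right locally testable if and only if $S$ is locally idempotent and no two distinct idempotents $e,i$ lying in a common right zero subsemigroup of $S$ have a common right unit in $S$. Likewise, $S$ is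 left locally testable if and only if $S$ is locally idempotent and no two distinct idempotents $e,i$ lying in a common left zero subsemigroup of $S$ have a common left unit in $S$. -/

import Mathlib

namespace LocalTest

/-- The list of letters of a word of the free semigroup `Σ⁺`. -/
def letters {A : Type*} (w : FreeSemigroup A) : List A := w.head :: w.tail

/-- The set `F_k(w)` of segments (contiguous factors) of length `k` of the word `w`. -/
def segments {A : Type*} (k : ℕ) (w : List A) : Set (List A) :=
  {x | x <:+: w ∧ x.length = k}

/-- `x` appears before `y` in the prefixes of `w`: some prefix of `w` already contains the
segment `x` but not yet the segment `y`. -/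
def AppearsBeforeInPrefixes {A : Type*} (w x y : List A) : Prop :=
  ∃ p, p <+: w ∧ x <:+: p ∧ ¬ y <:+: p

/-- `x` appears before `y` in the suffixes of `w`: some suffix of `w` already contains the
segment `x` but not yet the segment `y`. -/
def AppearsBeforeInSuffixes {A : Type*} (w x y : List A) : Prop :=
  ∃ s, s <:+ w ∧ x <:+: s ∧ ¬ y <:+: s

/-- `u` and `v` have the same prefix of length `k - 1`, the same suffix of length `k - 1` (where
a word shorter than `k - 1` is its own prefix and suffix) and the same segments of length `k`. -/
def SameTests {A : Type*} (k : ℕ) (u v : List A) : Prop :=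
  u.take (k - 1) = v.take (k - 1) ∧ u.rtake (k - 1) = v.rtake (k - 1) ∧
    segments k u = segments k v

/-- `u` and `v` pass the same tests, and their segments of length `k` appear in the same order
in prefixes. -/
def RightEquiv {A : Type*} (k : ℕ) (u v : List A) : Prop :=
  SameTests k u v ∧
    ∀ x ∈ segments k u, ∀ y ∈ segments k u,
      (AppearsBeforeInPrefixes u x y ↔ AppearsBeforeInPrefixes v x y)

/-- `u` and `v` pass the same tests, and their segments of length `k` appear in the same order
in suffixes. -/
def LeftEquiv {A : Type*} (k : ℕ) (u v : List A) : Prop :=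
  SameTests k u v ∧
    ∀ x ∈ segments k u, ∀ y ∈ segments k u,
      (AppearsBeforeInSuffixes u x y ↔ AppearsBeforeInSuffixes v x y)

/-- A semigroup is right `k`-testable if for some finite alphabet `A` and some surjective morphism
`φ : A⁺ → S`, right `k`-equivalent words have the same image. -/
def IsRightKTestable (S : Type*) [Semigroup S] (k : ℕ) : Prop :=
  ∃ (A : Type) (_ : Finite A) (φ : FreeSemigroup A →ₙ* S), Function.Surjective φ ∧
    ∀ u v : FreeSemigroup A, RightEquiv k (letters u) (letters v) → φ u = φ v

/-- A semigroup is left `k`-testable if for some finite alphabet `A` and some surjective morphism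
`φ : A⁺ → S`, left `k`-equivalent words have the same image. -/
def IsLeftKTestable (S : Type*) [Semigroup S] (k : ℕ) : Prop :=
  ∃ (A : Type) (_ : Finite A) (φ : FreeSemigroup A →ₙ* S), Function.Surjective φ ∧
    ∀ u v : FreeSemigroup A, LeftEquiv k (letters u) (letters v) → φ u = φ v

/-- Right locally testable: right `k`-testable for some positive integer `k`. -/
def IsRightLocallyTestable (S : Type*) [Semigroup S] : Prop :=
  ∃ k : ℕ, 0 < k ∧ IsRightKTestable S k

/-- Left locally testable: left `k`-testable for some positive integer `k`. -/
def IsLeftLocallyTestable (S : Type*) [Semigroup S] : Prop :=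
  ∃ k : ℕ, 0 < k ∧ IsLeftKTestable S k

/-- Locally idempotent: for every idempotent `e`, all elements of the subsemigroup `eSe` are
idempotent. -/
def IsLocallyIdempotent (S : Type*) [Semigroup S] : Prop :=
  ∀ e : S, IsIdempotentElem e → ∀ x ∈ Subsemigroup.corner e, IsIdempotentElem x

/-- A subsemigroup satisfying the identity `xy = y`. -/
def IsRightZero {S : Type*} [Semigroup S] (T : Subsemigroup S) : Prop :=
  ∀ x ∈ T, ∀ y ∈ T, x * y = y

/-- A subsemigroup satisfying the identity `xy = x`. -/
def IsLeftZero {S : Type*} [Semigroup S] (T : Subsemigroup S) : Prop :=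
  ∀ x ∈ T, ∀ y ∈ T, x * y = x

/-- `e` and `i` have a common right unit: an idempotent `f` with `ef = e` and `if = i`. -/
def HaveCommonRightUnit {S : Type*} [Semigroup S] (e i : S) : Prop :=
  ∃ f : S, IsIdempotentElem f ∧ e * f = e ∧ i * f = i

/-- `e` and `i` have a common left unit: an idempotent `f` with `fe = e` and `fi = i`. -/
def HaveCommonLeftUnit {S : Type*} [Semigroup S] (e i : S) : Prop :=
  ∃ f : S, IsIdempotentElem f ∧ f * e = e ∧ f * i = i

end LocalTest

/-!
A finite semigroup satisfies the right-hand condition exactly when every local subsemigroup `fSf`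
is a left regular band, that is, satisfies `xyx = xy` (and hence `xx = x`): in a band `x * y` and
`x * y * x` form a right zero pair, while `e ↦ f * e` carries a right zero pair with common right
unit `f` injectively into `fSf`.

If `S` is right `k`-testable and `W` is a long word representing `f`, then `WuWvW` and `WuWvWuW`
have the same segments, the first being a prefix of the second, so they are right equivalent and
`xyx = xy` holds in `fSf` (`IsRightKTestable.isLeftRegularAt`).

Conversely let `N = |S| + 1` and `k = N + 1`. By the pigeonhole principle a word `y` of length `N`
splits as `y₁y₂` with the value of `y₁` fixed by right multiplication by an idempotent `e`. Words
`l` such that `yl` ends with `y` ("loops at `y`") therefore act after `y` through elements of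
`eSe`, so that `y l l' l` and `y l l'` have the same value. Idempotency shows that a word `r`
followed by a word `s` which creates no new segment can be returned to the value of `r`
(`exists_return`); the identity `xyx = xy` then shows that the value of `rs` depends only on the
last `N` letters of `rs` (`wordProd_append_eq`). Two right equivalent words `u = p a s` and
`v = q b t`, cut where their last new segment appears, have `a = b` and `p`, `q` right equivalent,
so the values agree by induction (`wordProd_eq_of_rightEquiv`).

The left-hand version follows by passing to the opposite semigroup.
-/

namespace LocalTest

/-! ### Segments of words -/

section Words

variable {A : Type*} {k N : ℕ}

lemma segments_mono {u v : List A} (h : u <:+: v) : segments k u ⊆ segments k v :=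
  fun _ hx => ⟨hx.1.trans h, hx.2⟩

/-- A segment of length at most `|t| + 1` of `a t b` cannot meet both `a` and `b`. -/
lemma mem_segments_append {a t b x : List A} (ht : k ≤ t.length + 1)
    (hx : x ∈ segments k (a ++ t ++ b)) :
    x ∈ segments k (a ++ t) ∨ x ∈ segments k (t ++ b) := by
  obtain ⟨⟨l, r, h⟩, hk⟩ := hx
  rw [List.append_assoc, List.append_assoc] at h
  rcases List.append_eq_append_iff.1 h with ⟨c, rfl, h2⟩ | ⟨c, rfl, h2⟩
  · rcases List.append_eq_append_iff.1 ((List.append_assoc c t b).trans h2.symm) with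
      ⟨d, rfl, -⟩ | ⟨d, h3, -⟩
    · simp only [List.length_append] at hk
      rcases c with _ | ⟨c, cs⟩
      · exact Or.inr ⟨⟨[], r, by simpa using h2⟩, by simpa using hk⟩
      · have : d = [] := by
          apply List.eq_nil_of_length_eq_zero
          simp only [List.length_cons] at hk
          omega
        subst this
        exact Or.inl ⟨⟨l, [], by simp⟩, by simpa [Nat.add_right_comm] using hk⟩
    · exact Or.inl ⟨⟨l, d, by simp [h3]⟩, hk⟩
  · exact Or.inr ⟨⟨c, r, by simp [h2]⟩, hk⟩

lemma segments_append_subset {a t b r : List A} (ht : k ≤ t.length + 1)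
    (h₁ : segments k (a ++ t) ⊆ segments k r) (h₂ : segments k (t ++ b) ⊆ segments k r) :
    segments k (a ++ t ++ b) ⊆ segments k r :=
  fun _ hx => (mem_segments_append ht hx).elim (@h₁ _) (@h₂ _)

lemma exists_eq_append_suffix {r : List A} (h : N ≤ r.length) :
    ∃ q y, r = q ++ y ∧ y.length = N :=
  ⟨r.take (r.length - N), r.drop (r.length - N), by simp, by simp; omega⟩

lemma rtake_append_self (q y : List A) : (q ++ y).rtake y.length = y := by
  simp [List.rtake]

/-- The words `r` and `s` of length at least `N` have the same last `N` letters. -/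
def SameEnd (N : ℕ) (r s : List A) : Prop := ∃ y, y.length = N ∧ y <:+ r ∧ y <:+ s

lemma SameEnd.eq_suffix {q y s : List A} (h : SameEnd y.length (q ++ y) s) : y <:+ s := by
  obtain ⟨z, hz, h₁, h₂⟩ := h
  rwa [(List.suffix_of_suffix_length_le h₁ (List.suffix_append q y) hz.le).eq_of_length hz] at h₂

lemma suffix_append_of_suffix {q y l : List A} (h : y <:+ q ++ y ++ l) : y <:+ y ++ l := by
  rw [List.append_assoc] at h
  exact List.suffix_of_suffix_length_le h (List.suffix_append _ _) (by simp)

/-- First appearances in a prefix `p` of `w` are first appearances in `w`. -/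
lemma appearsBeforeInPrefixes_iff {p w x y : List A} (h : p <+: w) (hy : y <:+: p) :
    AppearsBeforeInPrefixes w x y ↔ AppearsBeforeInPrefixes p x y := by
  constructor
  · rintro ⟨q, hq, hx, hny⟩
    rcases List.prefix_or_prefix_of_prefix h hq with h' | h'
    · exact absurd (hy.trans h'.isInfix) hny
    · exact ⟨q, h', hx, hny⟩
  · rintro ⟨q, hq, hx, hny⟩
    exact ⟨q, hq.trans h, hx, hny⟩

/-- A word of length greater than `N`, cut at the first appearance of its last new segment of
length `N + 1`: this segment is `y a`, where `p = q y`. -/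
lemma exists_last_new_segment (u : List A) (hu : N < u.length) :
    ∃ q y a s, u = q ++ y ++ a :: s ∧ y.length = N ∧
      y ++ [a] ∉ segments (N + 1) (q ++ y) ∧
      segments (N + 1) u ⊆ segments (N + 1) (q ++ y ++ [a]) := by
  induction u using List.reverseRecOn with
  | nil => simp at hu
  | append_singleton u a ih =>
    have hu' : N ≤ u.length := by simpa [Nat.lt_succ_iff] using hu
    obtain ⟨q, y, rfl, hy⟩ := exists_eq_append_suffix hu'
    by_cases hx : y ++ [a] ∈ segments (N + 1) (q ++ y)
    · have hlt : N < (q ++ y).length := by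
        have := hx.1.length_le
        rw [hx.2] at this
        omega
      obtain ⟨q', y', b, s, h, hy', hn, hs⟩ := ih hlt
      refine ⟨q', y', b, s ++ [a], by simp [h], hy', hn, ?_⟩
      refine segments_append_subset (by omega) hs ?_
      rintro z ⟨hz, hzl⟩
      have : z = y ++ [a] := hz.eq_of_length (by simp [hzl, hy])
      exact hs (this ▸ hx)
    · exact ⟨q, y, a, [], rfl, hy, hx, subset_rfl⟩

end Words

/-! ### Values of words over a locally left regular monoid -/

section Values

variable {A M : Type*} [Monoid M]

/-- The value of a word in a monoid under the evaluation `f` of the letters. -/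
def wordProd (f : A → M) (w : List A) : M := (w.map f).prod

lemma wordProd_append (f : A → M) (u v : List A) :
    wordProd f (u ++ v) = wordProd f u * wordProd f v := by
  simp [wordProd]

/-- `e` is an idempotent and `e M e` satisfies `xyx = xy`. -/
def IsLeftRegularAt {M : Type*} [Mul M] (e : M) : Prop :=
  e * e = e ∧ ∀ x y : M, e * x * e * y * e * x * e = e * x * e * y * e

/-- Some prefix of the word `y` has a value fixed by right multiplication by an idempotent at
which the monoid is left regular. -/
def IsStabilized (f : A → M) (y : List A) : Prop :=
  ∃ y₁ y₂ e, y = y₁ ++ y₂ ∧ wordProd f y₁ * e = wordProd f y₁ ∧ IsLeftRegularAt e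

variable {f : A → M} {N : ℕ}

/-- A loop `l` at `y = y₁ y₂` is conjugated by `y₂` to a word `m` with value `c` such that
`y₁ m` ends with `y₁`. -/
lemma exists_conj_of_loop {y₁ y₂ l : List A} (h : y₁ ++ y₂ <:+ y₁ ++ y₂ ++ l) :
    ∃ c d : M, wordProd f y₂ * wordProd f l = c * wordProd f y₂ ∧
      wordProd f y₁ * c = d * wordProd f y₁ := by
  obtain ⟨z, hz⟩ := h
  have hp : y₁ <+: z ++ y₁ := by
    refine List.prefix_of_prefix_length_le (l₃ := y₁ ++ y₂ ++ l) ⟨y₂ ++ l, by simp⟩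
      ⟨y₂, by simp [← hz]⟩ (by simp)
  obtain ⟨m, hm⟩ := hp
  have h2 : m ++ y₂ = y₂ ++ l := by
    rw [← List.append_assoc, ← hm] at hz
    simpa using hz
  exact ⟨wordProd f m, wordProd f z, by rw [← wordProd_append, ← h2, wordProd_append],
    by rw [← wordProd_append, hm, wordProd_append]⟩

/-- The local identity `xyx = xy` for loops at a stabilized word. -/
lemma IsStabilized.loop_mul_loop {y l l' : List A} (hy : IsStabilized f y) (hl : y <:+ y ++ l)
    (hl' : y <:+ y ++ l') :
    wordProd f (y ++ l ++ l' ++ l) = wordProd f (y ++ l ++ l') := by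
  obtain ⟨y₁, y₂, e, rfl, hfix, -, hlrb⟩ := hy
  obtain ⟨c, d, hc, hd⟩ := exists_conj_of_loop (f := f) hl
  obtain ⟨c', d', hc', hd'⟩ := exists_conj_of_loop (f := f) hl'
  simp only [wordProd_append]
  generalize wordProd f y₁ = a at *
  generalize wordProd f y₂ = b at *
  generalize wordProd f l = x at *
  generalize wordProd f l' = x' at *
  -- right multiplication by `e` may be inserted after each of `c`, `c'`
  have h1 : a * c = a * (e * c * e) := by
    rw [← mul_assoc, ← mul_assoc, hfix, hd, mul_assoc, hfix]
  have h2 : a * c * c' = a * (e * c * e * c' * e) := by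
    have key : a * c * c' = d * d' * a := by rw [hd, mul_assoc d a, hd', mul_assoc]
    calc a * c * c' = a * c * c' * e := by rw [key, mul_assoc _ a e, hfix]
      _ = _ := by rw [h1]; simp only [mul_assoc]
  have h3 : a * c * c' * c = a * (e * c * e * c' * e * c * e) := by
    have key : a * c * c' * c = d * d' * d * a := by
      rw [hd, mul_assoc d a, hd', mul_assoc, mul_assoc d' a, hd]
      simp only [mul_assoc]
    calc a * c * c' * c = a * c * c' * c * e := by rw [key, mul_assoc _ a e, hfix]
      _ = _ := by rw [h2]; simp only [mul_assoc]
  calc a * b * x * x' * x = a * c * c' * c * b := by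
        rw [mul_assoc a, hc, ← mul_assoc, mul_assoc _ b x', hc', ← mul_assoc, mul_assoc _ b x, hc]
        simp only [mul_assoc]
    _ = a * c * c' * b := by rw [h3, hlrb, ← h2]
    _ = a * b * x * x' := by
        rw [mul_assoc a b, hc, ← mul_assoc, mul_assoc _ b x', hc']
        simp only [mul_assoc]

lemma IsStabilized.loop_mul_self {y l : List A} (hy : IsStabilized f y) (hl : y <:+ y ++ l) :
    wordProd f (y ++ l ++ l) = wordProd f (y ++ l) := by
  simpa using hy.loop_mul_loop hl (l' := []) (by simp)

variable (hf : ∀ y : List A, y.length = N → IsStabilized f y)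

include hf

/-- A letter creating no new segment can be continued to a word with the original value. -/
lemma exists_return_letter {r : List A} {a : A} (hr : N ≤ r.length)
    (h : segments (N + 1) (r ++ [a]) ⊆ segments (N + 1) r) :
    ∃ s, wordProd f (r ++ a :: s) = wordProd f r ∧
      segments (N + 1) (r ++ a :: s) ⊆ segments (N + 1) r ∧ SameEnd N r (r ++ a :: s) := by
  obtain ⟨q, y, rfl, hy⟩ := exists_eq_append_suffix hr
  obtain ⟨⟨r₁, r₂, hr'⟩, -⟩ := h (show y ++ [a] ∈ _ from ⟨⟨q, [], by simp⟩, by simp [hy]⟩)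
  have hr'' : r₁ ++ y ++ a :: r₂ = q ++ y := by simpa using hr'
  have hl : y <:+ y ++ a :: r₂ :=
    suffix_append_of_suffix (q := r₁) (hr'' ▸ List.suffix_append q y)
  refine ⟨r₂, ?_, ?_, y, hy, List.suffix_append _ _, ?_⟩
  · have := congrArg (wordProd f r₁ * ·) ((hf y hy).loop_mul_self hl)
    simp only [← wordProd_append] at this
    rw [← hr'']
    simpa using this
  · refine segments_append_subset (by omega) subset_rfl (segments_mono ?_)
    exact ⟨r₁, [], by simpa using hr''⟩
  · rw [List.append_assoc]
    exact hl.trans (List.suffix_append _ _)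

/-- A word creating no new segment can be continued to a word with the original value. -/
lemma exists_return (s r : List A) (hr : N ≤ r.length)
    (h : segments (N + 1) (r ++ s) ⊆ segments (N + 1) r) :
    ∃ s', wordProd f (r ++ s ++ s') = wordProd f r ∧
      segments (N + 1) (r ++ s ++ s') ⊆ segments (N + 1) r ∧ SameEnd N r (r ++ s ++ s') := by
  induction s generalizing r with
  | nil =>
    obtain ⟨q, y, rfl, hy⟩ := exists_eq_append_suffix hr
    exact ⟨[], by simp, by simp, y, hy, by simp⟩
  | cons a s ih =>
    have ha : segments (N + 1) (r ++ [a]) ⊆ segments (N + 1) r :=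
      (segments_mono ⟨[], s, by simp⟩).trans h
    obtain ⟨s₁, hv₁, hs₁, he₁⟩ := exists_return_letter hf hr ha
    obtain ⟨s₂, hv₂, hs₂, y, hy, hy₁, hy₂⟩ := ih (r ++ [a]) (by simp; omega) (by
      simp only [List.append_assoc, List.singleton_append]
      exact h.trans (segments_mono ⟨[], [a], by simp⟩))
    obtain ⟨q₁, hq₁⟩ := hy₁
    obtain ⟨q₂, hq₂⟩ := hy₂
    have e₁ : r ++ a :: s₁ = q₁ ++ y ++ s₁ := by simp [hq₁]
    have e₂ : r ++ a :: s ++ (s₂ ++ s₁) = q₂ ++ y ++ s₁ := by simp [hq₂]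
    obtain ⟨q, z, rfl, hz⟩ := exists_eq_append_suffix hr
    refine ⟨s₂ ++ s₁, ?_, ?_, z, hz, List.suffix_append _ _, ?_⟩
    · rw [e₂, wordProd_append, hq₂, hv₂, ← wordProd_append]
      simpa using hv₁
    · rw [e₂]
      refine segments_append_subset (by omega) (hq₂ ▸ hs₂.trans ha) ((segments_mono ?_).trans hs₁)
      rw [e₁]
      exact ⟨q₁, [], by simp⟩
    · rw [e₂]
      subst hz
      have hz' := he₁.eq_suffix
      rw [e₁, List.append_assoc] at hz'
      have := List.suffix_of_suffix_length_le hz' (List.suffix_append _ _) (by simp; omega)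
      rw [List.append_assoc]
      exact this.trans (List.suffix_append _ _)

/-- A loop creating no new segment does not change the value. -/
lemma wordProd_append_loop {r l : List A} (hr : N ≤ r.length)
    (h : segments (N + 1) (r ++ l) ⊆ segments (N + 1) r) (he : SameEnd N r (r ++ l)) :
    wordProd f (r ++ l) = wordProd f r := by
  obtain ⟨l', hv, -, he'⟩ := exists_return hf l r hr h
  obtain ⟨q, y, rfl, rfl⟩ := exists_eq_append_suffix hr
  have hl := suffix_append_of_suffix he.eq_suffix
  have hl' : y <:+ y ++ l' := by
    obtain ⟨z, hz⟩ := hl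
    have := he'.eq_suffix
    rw [List.append_assoc q, ← hz, ← List.append_assoc] at this
    exact suffix_append_of_suffix this
  calc wordProd f (q ++ y ++ l) = wordProd f (q ++ y ++ l ++ l') * wordProd f l := by
        rw [hv, wordProd_append]
    _ = wordProd f q * wordProd f (y ++ l ++ l' ++ l) := by
        simp only [wordProd_append, mul_assoc]
    _ = wordProd f (q ++ y ++ l ++ l') := by
        rw [(hf y rfl).loop_mul_loop hl hl']
        simp only [wordProd_append, mul_assoc]
    _ = wordProd f (q ++ y) := hv

/-- After `r`, the value of a continuation creating no new segment depends only on where it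
ends. -/
lemma wordProd_append_eq {r s t : List A} (hr : N ≤ r.length)
    (hs : segments (N + 1) (r ++ s) ⊆ segments (N + 1) r)
    (ht : segments (N + 1) (r ++ t) ⊆ segments (N + 1) r) (he : SameEnd N (r ++ s) (r ++ t)) :
    wordProd f (r ++ s) = wordProd f (r ++ t) := by
  obtain ⟨z, hv, hz, he'⟩ := exists_return hf s r hr hs
  obtain ⟨q, y, rfl, hy⟩ := exists_eq_append_suffix hr
  subst hy
  obtain ⟨q', hq'⟩ := he'.eq_suffix
  have e : q ++ y ++ s ++ (z ++ t) = q' ++ y ++ t := by simp [hq']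
  have key : wordProd f (q ++ y ++ s ++ (z ++ t)) = wordProd f (q ++ y ++ s) := by
    refine wordProd_append_loop hf (by simp; omega) ?_ ?_
    · refine subset_trans ?_ (segments_mono (List.prefix_append (q ++ y) s).isInfix)
      rw [e]
      exact segments_append_subset (by omega) (hq' ▸ hz)
        ((segments_mono ⟨q, [], by simp⟩).trans ht)
    · obtain ⟨x, hx, hx₁, hx₂⟩ := he
      refine ⟨x, hx, hx₁, ?_⟩
      rw [List.append_assoc] at hx₂
      rw [e, List.append_assoc]
      exact (List.suffix_of_suffix_length_le hx₂ (List.suffix_append _ _)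
        (by simp; omega)).trans (List.suffix_append _ _)
  rw [← key, ← List.append_assoc, wordProd_append, hv, ← wordProd_append]

/-- Right equivalent words have the same value. -/
lemma wordProd_eq_of_rightEquiv {u v : List A} (h : RightEquiv (N + 1) u v) :
    wordProd f u = wordProd f v := by
  induction hn : u.length using Nat.strong_induction_on generalizing u v with
  | _ n ih =>
  obtain ⟨⟨htake, hrtake, hseg⟩, hord⟩ := h
  simp only [Nat.add_sub_cancel] at htake hrtake
  have hlen := congrArg List.length htake
  simp only [List.length_take] at hlen
  -- words without segments of length `N + 1` are determined by their prefixes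
  have short : ∀ {u v : List A}, u.take N = v.take N → u.length ≤ N → v.length ≤ N → u = v := by
    intro u v h hu hv
    rwa [List.take_of_length_le hu, List.take_of_length_le hv] at h
  have long : ∀ {u v : List A}, segments (N + 1) u = segments (N + 1) v → N < u.length →
      N < v.length := by
    intro u v h hu
    have : u.take (N + 1) ∈ segments (N + 1) u :=
      ⟨(List.take_prefix _ _).isInfix, by simp; omega⟩
    rw [h] at this
    have h2 := this.1.length_le
    rw [this.2] at h2
    omega
  rcases le_or_gt u.length N with hu | hu
  · have hv : v.length ≤ N := by
      by_contra hv
      exact absurd (long hseg.symm (not_le.1 hv)) (not_lt.2 hu)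
    rw [short htake hu hv]
  have hv := long hseg hu
  obtain ⟨q, y, a, s, rfl, hy, hnew, hall⟩ := exists_last_new_segment u hu
  obtain ⟨q', y', a', s', rfl, hy', hnew', hall'⟩ := exists_last_new_segment v hv
  have hmem : y ++ [a] ∈ segments (N + 1) (q ++ y ++ a :: s) :=
    ⟨⟨q, s, by simp⟩, by simp [hy]⟩
  have hmem' : y' ++ [a'] ∈ segments (N + 1) (q' ++ y' ++ a' :: s') :=
    ⟨⟨q', s', by simp⟩, by simp [hy']⟩
  -- a segment of a word, other than the last new one, appears before it
  have old : ∀ {q y : List A} {a : A} {x : List A}, y.length = N →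
      x ∈ segments (N + 1) (q ++ y ++ [a]) → x ≠ y ++ [a] → x ∈ segments (N + 1) (q ++ y) := by
    intro q y a x hy hx hne
    rcases mem_segments_append (by omega) hx with hx | hx
    · exact hx
    · exact absurd (hx.1.eq_of_length (by simp [hx.2, hy])) hne
  have heq : y ++ [a] = y' ++ [a'] := by
    by_contra hne
    have h1 : y' ++ [a'] ∈ segments (N + 1) (q ++ y) :=
      old hy (hall (hseg ▸ hmem')) (Ne.symm hne)
    have h2 : AppearsBeforeInPrefixes (q ++ y ++ a :: s) (y' ++ [a']) (y ++ [a]) :=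
      ⟨q ++ y, List.prefix_append _ _, h1.1, fun hc => hnew ⟨hc, by simp [hy]⟩⟩
    obtain ⟨p, hp, hp₁, hp₂⟩ := (hord _ (hseg ▸ hmem') _ hmem).1 h2
    have h3 : y ++ [a] ∈ segments (N + 1) (q' ++ y') := old hy' (hall' (hseg ▸ hmem)) hne
    rcases List.prefix_or_prefix_of_prefix hp (List.prefix_append (q' ++ y') (a' :: s'))
      with hc | hc
    · exact hnew' ⟨hp₁.trans hc.isInfix, by simp [hy']⟩
    · exact hp₂ (h3.1.trans hc.isInfix)
  obtain ⟨rfl, ha⟩ := List.append_inj' heq rfl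
  obtain rfl : a = a' := by simpa using ha
  have hpseg : segments (N + 1) (q ++ y) = segments (N + 1) (q' ++ y) := by
    ext x
    constructor
    · intro hx
      refine old hy (hall' (hseg ▸ segments_mono (List.prefix_append _ _).isInfix hx)) ?_
      rintro rfl
      exact hnew hx
    · intro hx
      refine old hy (hall (hseg ▸ segments_mono (List.prefix_append _ _).isInfix hx)) ?_
      rintro rfl
      exact hnew' hx
  have hp : wordProd f (q ++ y) = wordProd f (q' ++ y) := by
    refine ih _ ?_ ⟨⟨?_, ?_, hpseg⟩, ?_⟩ rfl
    · rw [← hn]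
      simp
    · rwa [List.take_append_of_le_length (l₁ := q ++ y) (by simp; omega),
        List.take_append_of_le_length (l₁ := q' ++ y) (by simp; omega)] at htake
    · subst hy
      simp [rtake_append_self]
    · intro x hx z hz
      have hz' := hpseg ▸ hz
      rw [← appearsBeforeInPrefixes_iff (List.prefix_append (q ++ y) (a :: s)) hz.1,
        ← appearsBeforeInPrefixes_iff (List.prefix_append (q' ++ y) (a :: s')) hz'.1]
      exact hord _ (segments_mono (List.prefix_append _ _).isInfix hx) _
        (segments_mono (List.prefix_append _ _).isInfix hz)
  have hswap : wordProd f (q' ++ y ++ a :: s') = wordProd f (q ++ y ++ [a] ++ s') := by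
    rw [wordProd_append, ← hp, ← wordProd_append]
    simp
  rw [hswap, ← List.singleton_append, ← List.append_assoc]
  refine wordProd_append_eq hf (by simp; omega) (by simpa using hall) ?_ ?_
  · rw [List.append_assoc q]
    refine segments_append_subset (by simp; omega) subset_rfl ?_
    rw [← List.append_assoc]
    refine (segments_mono ?_).trans (hseg.symm.subset.trans hall)
    exact ⟨q', [], by simp⟩
  · obtain ⟨c, z, hcz, hz⟩ := exists_eq_append_suffix hu.le
    obtain ⟨c', z', hcz', hz'⟩ := exists_eq_append_suffix hv.le
    have : z = z' := by
      rw [hcz, hcz'] at hrtake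
      subst hz
      rwa [rtake_append_self, ← hz', rtake_append_self] at hrtake
    subst this
    refine ⟨z, hz, ⟨c, by simp [← hcz]⟩, ?_⟩
    have h1 : z <:+ q' ++ (y ++ a :: s') := ⟨c', by simp [← hcz']⟩
    have h2 := List.suffix_of_suffix_length_le h1 (List.suffix_append _ _) (by simp; omega)
    exact h2.trans ⟨q, by simp⟩

end Values

/-! ### Evaluation of words in a semigroup -/

section Semigroups

lemma letters_mul {A : Type*} (u v : FreeSemigroup A) :
    letters (u * v) = letters u ++ letters v := by
  simp [letters]

lemma letters_of {A : Type*} (a : A) : letters (FreeSemigroup.of a) = [a] := rfl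

variable {S : Type*} [Semigroup S]

lemma coe_map_eq_wordProd {A : Type*} (φ : FreeSemigroup A →ₙ* S) (w : FreeSemigroup A) :
    (φ w : WithOne S) = wordProd (fun a => (φ (FreeSemigroup.of a) : WithOne S)) (letters w) := by
  induction w using FreeSemigroup.recOnMul with
  | ih1 a => simp [letters_of, wordProd]
  | ih2 a w ha hw => rw [map_mul, WithOne.coe_mul, letters_mul, wordProd_append, ← ha, ← hw]

/-- Left regularity of `eSe` carries over to `eS¹e`. -/
lemma IsLeftRegularAt.coe {e : S} (h : IsLeftRegularAt e) : IsLeftRegularAt (e : WithOne S) := by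
  obtain ⟨h1, h2⟩ := h
  have key : ∀ x : WithOne S, ∃ x' : S, (e * x * e : WithOne S) = (e * x' * e : S) := by
    intro x
    refine WithOne.cases_on x ⟨e, ?_⟩ fun x => ⟨x, rfl⟩
    simp [h1, ← WithOne.coe_mul]
  have he : (e * e : WithOne S) = e := by rw [← WithOne.coe_mul, h1]
  have he' : ∀ z : WithOne S, e * (e * z) = e * z := fun z => by rw [← mul_assoc, he]
  have h1' : ∀ z, e * (e * z) = e * z := fun z => by rw [← mul_assoc, h1]
  refine ⟨he, fun x y => ?_⟩
  obtain ⟨x', hx⟩ := key x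
  obtain ⟨y', hy⟩ := key y
  have hS : (e * x' * e) * (e * y' * e) * (e * x' * e) = (e * x' * e) * (e * y' * e) := by
    simpa only [mul_assoc, h1'] using h2 x' y'
  have hM : (e * x * e : WithOne S) * (e * y * e) * (e * x * e) = (e * x * e) * (e * y * e) := by
    rw [hx, hy, ← WithOne.coe_mul, ← WithOne.coe_mul, hS]
  simpa only [mul_assoc, he'] using hM

/-- In a finite semigroup, long words have a prefix fixed by an idempotent. -/
lemma isStabilized_of_length [Finite S] (hS : ∀ e : S, IsIdempotentElem e → IsLeftRegularAt e)
    {A : Type*} (f : A → S) (y : List A) (hy : y.length = Nat.card S + 1) :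
    IsStabilized (fun a => (f a : WithOne S)) y := by
  set F : A → WithOne S := fun a => (f a : WithOne S)
  have hcard : Nat.card (WithOne S) < Nat.card (Fin (y.length + 1)) := by
    have : Nat.card (WithOne S) = Nat.card S + 1 := Finite.card_option
    rw [this, Nat.card_fin, hy]
    omega
  have : Finite (WithOne S) := inferInstanceAs (Finite (Option S))
  obtain ⟨i, j, hij, hv⟩ : ∃ i j : Fin (y.length + 1), i < j ∧
      wordProd F (y.take i) = wordProd F (y.take j) := by
    have hni : ¬ Function.Injective fun i : Fin (y.length + 1) => wordProd F (y.take i) :=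
      fun h => absurd (Nat.card_le_card_of_injective _ h) (not_le.2 hcard)
    simp only [Function.Injective, not_forall] at hni
    obtain ⟨i, j, h, hne⟩ := hni
    rcases lt_or_gt_of_ne hne with hlt | hlt
    · exact ⟨i, j, hlt, h⟩
    · exact ⟨j, i, hlt, h.symm⟩
  have hcoe : ∀ w : List A, w ≠ [] → ∃ g : S, wordProd F w = g := by
    intro w hw
    induction w with
    | nil => exact absurd rfl hw
    | cons a w ih =>
      by_cases h : w = []
      · exact ⟨f a, by simp [h, wordProd, F]⟩
      · obtain ⟨g, hg⟩ := ih h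
        exact ⟨f a * g, by rw [WithOne.coe_mul, ← hg]; simp [wordProd, F]⟩
  have hlt : (i : ℕ) < j := hij
  have hjl := j.2
  obtain ⟨g, hg⟩ := hcoe ((y.take j).drop i) (by
    intro h
    have := congrArg List.length h
    simp at this
    omega)
  have hag : wordProd F (y.take i) * g = wordProd F (y.take i) := by
    have : y.take i = (y.take j).take i := by rw [List.take_take, min_eq_left hlt.le]
    rw [← hg, ← wordProd_append, this, List.take_append_drop, ← this, hv]
  let _ : TopologicalSpace S := ⊥
  have : DiscreteTopology S := ⟨rfl⟩
  obtain ⟨e, he, hee⟩ := exists_idempotent_in_compact_subsemigroup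
    (fun _ : S => continuous_of_discreteTopology) {x : S | wordProd F (y.take i) * x = wordProd F (y.take i)} ⟨g, hag⟩
    (Set.toFinite _).isCompact (by
      intro x hx z hz
      simp only [Set.mem_ofPred_eq] at *
      rw [WithOne.coe_mul, ← mul_assoc, hx, hz])
  exact ⟨y.take i, y.drop i, e, (List.take_append_drop _ _).symm, he, (hS e hee).coe⟩

/-- A finite semigroup whose local subsemigroups satisfy `xyx = xy` is right locally testable. -/
lemma isRightLocallyTestable_of_isLeftRegularAt [Finite S]
    (hS : ∀ e : S, IsIdempotentElem e → IsLeftRegularAt e) : IsRightLocallyTestable S := by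
  refine ⟨Nat.card S + 1 + 1, by omega, Fin (Nat.card S), inferInstance,
    FreeSemigroup.lift (Finite.equivFin S).symm, ?_, ?_⟩
  · intro s
    exact ⟨FreeSemigroup.of (Finite.equivFin S s), by simp⟩
  · intro u v h
    rw [← WithOne.coe_inj, coe_map_eq_wordProd, coe_map_eq_wordProd]
    exact wordProd_eq_of_rightEquiv
      (fun y hy => isStabilized_of_length hS (fun a => _) y hy) h

/-! ### Local subsemigroups of right testable semigroups -/

/-- Prolonging a word `p W` to a word ending with `W` without creating new segments gives a right
equivalent word. -/
lemma rightEquiv_append {A : Type*} {k : ℕ} {p W q : List A} (hW : k ≤ W.length)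
    (h : W ++ q ++ W <:+: p ++ W) : RightEquiv k (p ++ W) (p ++ W ++ (q ++ W)) := by
  have hseg : segments k (p ++ W) = segments k (p ++ W ++ (q ++ W)) := by
    refine (segments_mono (List.prefix_append _ _).isInfix).antisymm ?_
    exact segments_append_subset (by omega) subset_rfl (segments_mono (by simpa using h))
  refine ⟨⟨?_, ?_, hseg⟩, ?_⟩
  · rw [List.take_append_of_le_length (l₁ := p ++ W) (by simp; omega)]
  · rw [List.rtake_eq_reverse_take_reverse, List.rtake_eq_reverse_take_reverse]
    simp only [List.reverse_append, List.append_assoc]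
    rw [List.take_append_of_le_length (by simp; omega),
      List.take_append_of_le_length (by simp; omega)]
  · intro x hx y hy
    exact (appearsBeforeInPrefixes_iff (List.prefix_append _ _) hy.1).symm

lemma IsRightKTestable.isLeftRegularAt {k : ℕ} (h : IsRightKTestable S k) {e : S}
    (he : IsIdempotentElem e) : IsLeftRegularAt e := by
  obtain ⟨A, -, φ, hφ, hk⟩ := h
  obtain ⟨W, hWe, hW⟩ : ∃ W, φ W = e ∧ k ≤ (letters W).length := by
    obtain ⟨w, hw⟩ := hφ e
    clear hk
    induction k with
    | zero => exact ⟨w, hw, by simp⟩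
    | succ k ih =>
      obtain ⟨W, h1, h2⟩ := ih
      refine ⟨W * w, by rw [map_mul, h1, hw, he.eq], ?_⟩
      rw [letters_mul, List.length_append]
      simp only [letters, List.length_cons] at *
      omega
  refine ⟨he, fun x y => ?_⟩
  obtain ⟨u, rfl⟩ := hφ x
  obtain ⟨v, rfl⟩ := hφ y
  have := hk (W * u * W * v * W) (W * u * W * v * W * (u * W)) (by
    simp only [letters_mul]
    exact rightEquiv_append hW ⟨[], letters v ++ letters W, by simp⟩)
  simp only [map_mul, hWe] at this
  simpa only [mul_assoc] using this.symm

/-- The condition on right zero pairs, added to local idempotency, says that local subsemigroups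
satisfy `xyx = xy`. -/
lemma forall_isLeftRegularAt_iff :
    (∀ e : S, IsIdempotentElem e → IsLeftRegularAt e) ↔
      IsLocallyIdempotent S ∧
        ∀ e i : S, IsIdempotentElem e → IsIdempotentElem i → e ≠ i →
          (∃ T : Subsemigroup S, IsRightZero T ∧ e ∈ T ∧ i ∈ T) → ¬ HaveCommonRightUnit e i := by
  constructor
  · intro h
    refine ⟨?_, ?_⟩
    · rintro e he _ ⟨x, rfl⟩
      have := (h e he).2 x e
      simp only [mul_assoc, he.eq] at this
      simp only [IsIdempotentElem, mul_assoc]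
      rw [← mul_assoc e e, he.eq, this]
    · rintro e i he - hne ⟨T, hT, heT, hiT⟩ ⟨f, hf, hef, hif⟩
      have hei := hT e heT i hiT
      have hie := hT i hiT e heT
      have h1 : f * e * f * i * f * e * f = f * e * f * i * f := (h f hf).2 e i
      -- the identity reads `f * e = f * i`
      have h2 : f * e = f * i := by
        simpa only [mul_assoc, hef, hif, hei, hie, ← mul_assoc e f, ← mul_assoc i f] using h1
      apply hne
      calc e = i * f * e := by rw [hif, hie]
        _ = i := by rw [mul_assoc, h2, ← mul_assoc, hif]; exact hT i hiT i hiT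
  · rintro ⟨hid, hz⟩ f hf
    refine ⟨hf, fun x y => ?_⟩
    have idem : ∀ z : S, f * z * f * (f * z * f) = f * z * f := fun z => hid f hf _ ⟨z, rfl⟩
    -- `a` and `b` are the elements of `fSf` represented by `xyx` and `xy`
    set b := f * x * f * y * f with hb
    set a := b * x * f with ha
    have hbf : b * f = b := by simp only [hb, mul_assoc, hf.eq]
    have haf : a * f = a := by simp only [ha, mul_assoc, hf.eq]
    have hbb : b * b = b := by
      have := idem (x * f * y)
      simpa only [hb, mul_assoc] using this
    have hba : b * a = a := by rw [ha, ← mul_assoc, ← mul_assoc, hbb]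
    have hab : a * b = b := by
      calc a * b = b * (f * x * f * (f * x * f)) * y * f := by
            simp only [ha, hb, mul_assoc, ← mul_assoc f f, hf.eq]
        _ = b * b := by rw [idem]; simp only [hb, mul_assoc]
        _ = b := hbb
    have haa : a * a = a := by
      calc a * a = a * b * x * f := by rw [ha]; simp only [mul_assoc]
        _ = a := by rw [hab]
    by_contra hne
    refine hz a b haa hbb hne ⟨⟨{a, b}, ?_⟩, ?_, ?_, ?_⟩ ⟨f, hf, haf, hbf⟩
    · rintro u v (rfl | rfl) (rfl | rfl)
      exacts [Or.inl haa, Or.inr hab, Or.inl hba, Or.inr hbb]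
    · rintro u (rfl | rfl) v (rfl | rfl) <;> assumption
    · exact Or.inl rfl
    · exact Or.inr rfl

lemma isRightLocallyTestable_iff (S : Type*) [Semigroup S] [Finite S] :
    IsRightLocallyTestable S ↔
      IsLocallyIdempotent S ∧
        ∀ e i : S, IsIdempotentElem e → IsIdempotentElem i → e ≠ i →
          (∃ T : Subsemigroup S, IsRightZero T ∧ e ∈ T ∧ i ∈ T) → ¬ HaveCommonRightUnit e i := by
  rw [← forall_isLeftRegularAt_iff]
  exact ⟨fun ⟨_, _, h⟩ _ he => h.isLeftRegularAt he, isRightLocallyTestable_of_isLeftRegularAt⟩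

end Semigroups

/-! ### Duality -/

section Duality

open MulOpposite

/-- Morphisms `φ` to `S` and `ψ` to `Sᵐᵒᵖ` which agree on letters take the same value on a word
and on its reversal, respectively. -/
lemma exists_reverse {A S : Type*} [Semigroup S] {φ : FreeSemigroup A →ₙ* S}
    {ψ : FreeSemigroup A →ₙ* Sᵐᵒᵖ}
    (h : ∀ a, ψ (FreeSemigroup.of a) = op (φ (FreeSemigroup.of a))) (w : FreeSemigroup A) :
    ∃ w', letters w' = (letters w).reverse ∧ ψ w' = op (φ w) ∧ ψ w = op (φ w') := by
  induction w using FreeSemigroup.recOnMul with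
  | ih1 a => exact ⟨FreeSemigroup.of a, rfl, h a, h a⟩
  | ih2 a w ha hw =>
    obtain ⟨a', h1, h2, h3⟩ := ha
    obtain ⟨w', h4, h5, h6⟩ := hw
    exact ⟨w' * a', by simp [letters_mul, h1, h4], by rw [map_mul, h2, h5, map_mul, op_mul],
      by rw [map_mul, h3, h6, map_mul, op_mul]⟩

section Reverse

variable {A : Type*} {k : ℕ}

lemma mem_segments_reverse {u x : List A} :
    x ∈ segments k u.reverse ↔ x.reverse ∈ segments k u := by
  simp only [segments, Set.mem_ofPred_eq, List.length_reverse]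
  rw [← List.reverse_infix, List.reverse_reverse]

lemma appearsBeforeInPrefixes_reverse {w x y : List A} :
    AppearsBeforeInPrefixes w.reverse x y ↔
      AppearsBeforeInSuffixes w x.reverse y.reverse := by
  constructor
  · rintro ⟨p, hp, hx, hy⟩
    refine ⟨p.reverse, ?_, List.reverse_infix.2 hx, fun h => hy (List.reverse_infix.1 h)⟩
    rwa [← List.reverse_prefix, List.reverse_reverse]
  · rintro ⟨p, hp, hx, hy⟩
    refine ⟨p.reverse, List.reverse_prefix.2 hp, ?_, fun h => hy ?_⟩
    · rwa [← List.reverse_infix, List.reverse_reverse]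
    · rwa [← List.reverse_infix, List.reverse_reverse] at h

lemma sameTests_reverse {u v : List A} : SameTests k u.reverse v.reverse ↔ SameTests k u v := by
  have hseg : segments k u.reverse = segments k v.reverse ↔ segments k u = segments k v := by
    simp only [Set.ext_iff, mem_segments_reverse]
    exact ⟨fun h x => by simpa using h x.reverse, fun h x => h _⟩
  simp only [SameTests, hseg, List.rtake_eq_reverse_take_reverse, List.reverse_reverse,
    List.reverse_inj]
  tauto

lemma rightEquiv_reverse {u v : List A} :
    RightEquiv k u.reverse v.reverse ↔ LeftEquiv k u v := by
  simp only [RightEquiv, LeftEquiv, sameTests_reverse, mem_segments_reverse,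
    appearsBeforeInPrefixes_reverse]
  refine and_congr_right fun _ => ⟨fun h x hx y hy => ?_, fun h x hx y hy => h _ hx _ hy⟩
  simpa using h x.reverse (by simpa using hx) y.reverse (by simpa using hy)

end Reverse

variable {S : Type*} [Semigroup S]

lemma isRightKTestable_op {k : ℕ} : IsRightKTestable Sᵐᵒᵖ k ↔ IsLeftKTestable S k := by
  constructor
  · rintro ⟨A, hA, ψ, hψ, hk⟩
    set φ : FreeSemigroup A →ₙ* S :=
      FreeSemigroup.lift fun a => unop (ψ (FreeSemigroup.of a)) with hφ
    have hφψ : ∀ a, ψ (FreeSemigroup.of a) = op (φ (FreeSemigroup.of a)) := by simp [hφ]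
    refine ⟨A, hA, φ, fun s => ?_, fun u v h => ?_⟩
    · obtain ⟨w, hw⟩ := hψ (op s)
      obtain ⟨w', -, -, h⟩ := exists_reverse hφψ w
      exact ⟨w', op_injective (h.symm.trans hw)⟩
    · obtain ⟨u', hu, hu', -⟩ := exists_reverse hφψ u
      obtain ⟨v', hv, hv', -⟩ := exists_reverse hφψ v
      apply op_injective
      rw [← hu', ← hv']
      exact hk _ _ (by rw [hu, hv]; exact rightEquiv_reverse.2 h)
  · rintro ⟨A, hA, φ, hφ, hk⟩
    set ψ : FreeSemigroup A →ₙ* Sᵐᵒᵖ :=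
      FreeSemigroup.lift fun a => op (φ (FreeSemigroup.of a)) with hψ
    have hφψ : ∀ a, ψ (FreeSemigroup.of a) = op (φ (FreeSemigroup.of a)) := by simp [hψ]
    refine ⟨A, hA, ψ, fun s => ?_, fun u v h => ?_⟩
    · obtain ⟨w, hw⟩ := hφ (unop s)
      obtain ⟨w', -, h, -⟩ := exists_reverse hφψ w
      exact ⟨w', by rw [h, hw, op_unop]⟩
    · obtain ⟨u', hu, -, hu'⟩ := exists_reverse hφψ u
      obtain ⟨v', hv, -, hv'⟩ := exists_reverse hφψ v
      rw [hu', hv', hk]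
      rw [hu, hv, ← rightEquiv_reverse]
      simpa using h

lemma isLocallyIdempotent_op : IsLocallyIdempotent Sᵐᵒᵖ ↔ IsLocallyIdempotent S := by
  constructor
  · rintro h e he _ ⟨x, rfl⟩
    have := h (op e) (congrArg op he) _ ⟨op x, rfl⟩
    simpa only [IsIdempotentElem, ← op_mul, op_inj, mul_assoc] using this
  · rintro h e he _ ⟨x, rfl⟩
    have := h (unop e) (congrArg unop he) _ ⟨unop x, rfl⟩
    apply unop_injective
    simpa only [IsIdempotentElem, unop_mul, mul_assoc] using this

lemma exists_isRightZero_op {e i : S} :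
    (∃ T : Subsemigroup Sᵐᵒᵖ, IsRightZero T ∧ op e ∈ T ∧ op i ∈ T) ↔
      ∃ T : Subsemigroup S, IsLeftZero T ∧ e ∈ T ∧ i ∈ T := by
  constructor
  · rintro ⟨T, hT, he, hi⟩
    exact ⟨T.unop, fun x hx y hy => op_injective (hT _ hy _ hx), he, hi⟩
  · rintro ⟨T, hT, he, hi⟩
    exact ⟨T.op, fun x hx y hy => unop_injective (hT _ hy _ hx), he, hi⟩

lemma haveCommonRightUnit_op {e i : S} :
    HaveCommonRightUnit (op e) (op i) ↔ HaveCommonLeftUnit e i := by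
  constructor
  · rintro ⟨f, hf, he, hi⟩
    exact ⟨unop f, congrArg unop hf, congrArg unop he, congrArg unop hi⟩
  · rintro ⟨f, hf, he, hi⟩
    exact ⟨op f, congrArg op hf, congrArg op he, congrArg op hi⟩

lemma isLeftLocallyTestable_iff (S : Type*) [Semigroup S] [Finite S] :
    IsLeftLocallyTestable S ↔
      IsLocallyIdempotent S ∧
        ∀ e i : S, IsIdempotentElem e → IsIdempotentElem i → e ≠ i →
          (∃ T : Subsemigroup S, IsLeftZero T ∧ e ∈ T ∧ i ∈ T) → ¬ HaveCommonLeftUnit e i := by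
  have : Finite Sᵐᵒᵖ := Finite.of_equiv S opEquiv
  have h := isRightLocallyTestable_iff Sᵐᵒᵖ
  simp only [IsRightLocallyTestable, isRightKTestable_op, isLocallyIdempotent_op] at h
  refine h.trans (and_congr_right fun _ => ⟨fun h e i he hi hne hT => ?_,
    fun h e i he hi hne hT => ?_⟩)
  · rw [← haveCommonRightUnit_op]
    exact h _ _ (congrArg op he) (congrArg op hi) (op_injective.ne hne)
      (exists_isRightZero_op.2 hT)
  · rw [← op_unop e, ← op_unop i, haveCommonRightUnit_op]
    exact h _ _ (congrArg unop he) (congrArg unop hi) (unop_injective.ne hne)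
      (exists_isRightZero_op.1 hT)

end Duality

end LocalTest

theorem theorems3 (S : Type*) [Semigroup S] [Finite S] :
    (LocalTest.IsRightLocallyTestable S ↔
      LocalTest.IsLocallyIdempotent S ∧
        ∀ e i : S, IsIdempotentElem e → IsIdempotentElem i → e ≠ i →
          (∃ T : Subsemigroup S, LocalTest.IsRightZero T ∧ e ∈ T ∧ i ∈ T) →
            ¬ LocalTest.HaveCommonRightUnit e i) ∧
    (LocalTest.IsLeftLocallyTestable S ↔
      LocalTest.IsLocallyIdempotent S ∧
        ∀ e i : S, IsIdempotentElem e → IsIdempotentElem i → e ≠ i →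
          (∃ T : Subsemigroup S, LocalTest.IsLeftZero T ∧ e ∈ T ∧ i ∈ T) →
            ¬ LocalTest.HaveCommonLeftUnit e i) :=
  ⟨LocalTest.isRightLocallyTestable_iff S, LocalTest.isLeftLocallyTestable_iff S⟩
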